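/- Let $\mathcal I$ be a countable commutative semiring whose addition is cancellative (a multiplicative unit is not needed), and let $p:(\mathcal I,+)\to\mathbb Z_2$ be a monoid homomorphism (a parity function). Let $K(\mathcal I)$ be the Grothendieck group of $(\mathcal I,+)$; for $\alpha=[(j,k)]\in K(\mathcal I)$ and $i\in\mathcal I$ put $p(\alpha i)=p(ji)+p(ki)$. All algebras are real. Gradings are understood in the completed sense: an $\mathcal I$-graded algebra is a unital associative algebra $A$ with subspaces $A_i$ and projections $A\to A_i$ that identify $A$ with $\prod_{i\in\mathcal I}A_i$, such that $1\in A_0$ and $A_iA_j\subset A_{i+j}$. An $\mathcal I$-graded ringed space is a topological space with a sheaf of algebras whose algebras of sections are $\mathcal I$-graded, the restrictions being compatible with the projections to homogeneous components. Let $V$ be a finite-dimensional $\mathcal I$-graded real vector space with $V_0=0$ and $\dim V_i=m_i$, and let $S(V)=\bigoplus_n S^n(V)$ be its symmetric algebra, the quotient of the tensor algebra by the relations $v\otimes w=(-1)^{p(d(v)d(w))}w\otimes v$ for homogeneous $v,w$ of degrees $d(v),d(w)$. Let $\overline{S(V)}=\prod_n S^n(V)$. An $\mathcal I$-graded manifold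 $\mathcal M=(M,\mathcal O)$ of dimension $n|(m_i)$ is an $\mathcal I$-graded ringed space, with $M$ Hausdorff and second countable, such that every point of $M$ has an open neighbourhood $U$ for which there are a homeomorphism of $U$ onto an open subset $W$ of $\mathbb R^n$ and, over it, an isomorphism of $\mathcal O|_U$ with the sheaf of $\overline{S(V)}$-valued smooth functions on $W$, as sheaves of $\mathcal I$-graded algebras. (So $M$ is an $n$-dimensional manifold.) For $U\subset M$ open and $\alpha\in K(\mathcal I)$ let $\mathfrak X(U)_\alpha$ be the space of derivations of degree $\alpha$ of $\mathcal O(U)$, i.e. of linear maps $D:\mathcal O(U)\to\mathcal O(U)$ such that $D(\mathcal O(U)_i)\subset\mathcal O(U)_j$ whenever $j-i=\alpha$ in $K(\mathcal I)$, $D(\mathcal O(U)_i)=0$ if there is no such $j$, and $$D(fg)=D(f)\,g+(-1)^{p(\alpha i)}f\,D(g)\qquad\text{for all } f\in\mathcal O(U)_i,\ g\in\mathcal O(U).$$ The space of vector fields on $U$ is $\mathfrak X(U)=\prod_{\alpha\in K(\mathcal I)}\mathfrak X(U)_\alpha$. Then, for every $\mathcal I$-graded manifold $\mathcal M=(M,\mathcal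 O)$: 1. For all open $V\subset U\subset M$, all $\alpha\in K(\mathcal I)$ and all $D\in\mathfrak X(U)_\alpha$ there is a unique $D'\in\mathfrak X(V)_\alpha$ with $D'(f|_V)=D(f)|_V$ for all $f\in\mathcal O(U)$. 2. With the restriction maps $D\mapsto D'$ (taken in each degree), $\mathfrak X$ is a presheaf of $K(\mathcal I)$-graded real vector spaces on $M$, and it is a sheaf: $\mathfrak X_\alpha$ is a sheaf of real vector spaces on $M$ for every $\alpha\in K(\mathcal I)$, and so is $\mathfrak X$. -/

import Mathlib

open CategoryTheory TopologicalSpace Opposite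
open scoped Manifold ContDiff

universe u w

set_option linter.unusedSectionVars false

noncomputable section

namespace MonGraded

/-! ### Signs -/

section Signs

variable {I : Type w} [NonUnitalCommSemiring I]

/-- The Grothendieck group `K(I)` of the additive monoid `(I, +)`. -/
abbrev GK (I : Type w) [NonUnitalCommSemiring I] : Type w := Algebra.GrothendieckAddGroup I

/-- The canonical map `I → K(I)`, `a ↦ [(a, 0)]`. -/
abbrev toGK : I →+ GK I := Algebra.GrothendieckAddGroup.of

/-- `parityMul p α i` is the parity `p (α i)`: on `α = [(j, k)]` it is `p (j i) + p (k i)`. -/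
def parityMul (p : I →+ ZMod 2) (α : GK I) (i : I) : ZMod 2 :=
  Algebra.GrothendieckAddGroup.lift (p.comp (AddMonoidHom.mulRight i)) α

/-- The sign `(-1) ^ a` for `a : ℤ / 2`. -/
def sgn (a : ZMod 2) : ℝ := (-1) ^ a.val

end Signs

/-! ### The symmetric algebra and its completion -/

section Sym

variable {I : Type w} [NonUnitalCommSemiring I]

/-- A homogeneous basis of the graded vector space `V = ⨁ i, ℝ ^ (m i)`;
the basis vector `⟨i, a⟩` has degree `i`. -/
abbrev Gen (m : I →₀ ℕ) : Type w := Σ i : I, Fin (m i)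

/-- The relations `v ⊗ w = (-1) ^ p (d(v) d(w)) w ⊗ v` for basis vectors `v`, `w`. -/
inductive SymRel (p : I →+ ZMod 2) (m : I →₀ ℕ) :
    FreeAlgebra ℝ (Gen m) → FreeAlgebra ℝ (Gen m) → Prop
  | swap (v w : Gen m) : SymRel p m
      (FreeAlgebra.ι ℝ v * FreeAlgebra.ι ℝ w)
      (sgn (p (v.1 * w.1)) • (FreeAlgebra.ι ℝ w * FreeAlgebra.ι ℝ v))

/-- The symmetric algebra `S(V)`: the tensor algebra of `V` (the free algebra on a basis of `V`)
modulo graded commutativity. -/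
abbrev Sym (p : I →+ ZMod 2) (m : I →₀ ℕ) : Type w := RingQuot (SymRel p m)

variable (p : I →+ ZMod 2) (m : I →₀ ℕ)

/-- The image of a basis vector of `V` in `S(V)`. -/
def symGen (v : Gen m) : Sym p m := RingQuot.mkAlgHom ℝ (SymRel p m) (FreeAlgebra.ι ℝ v)

/-- The monomial of a word in the basis vectors. -/
def symWord (l : List (Gen m)) : Sym p m := (l.map (symGen p m)).prod

/-- The degree in `I` of a word. -/
def wordDeg (l : List (Gen m)) : I := (l.map Sigma.fst).sum

/-- `S^n(V)`, spanned by the monomials of length `n`. -/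
def symPow (n : ℕ) : Submodule ℝ (Sym p m) :=
  Submodule.span ℝ (symWord p m '' {l | l.length = n})

/-- `S(V)_i`, spanned by the monomials of degree `i`. -/
def symDeg (i : I) : Submodule ℝ (Sym p m) :=
  Submodule.span ℝ (symWord p m '' {l | wordDeg m l = i})

lemma symWord_append (l l' : List (Gen m)) :
    symWord p m (l ++ l') = symWord p m l * symWord p m l' := by
  simp [symWord]

lemma wordDeg_append (l l' : List (Gen m)) :
    wordDeg m (l ++ l') = wordDeg m l + wordDeg m l' := by
  simp [wordDeg]

lemma finite_words (n : ℕ) : {l : List (Gen m) | l.length = n}.Finite := by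
  have : Finite (Gen m) := by
    let f : Gen m → Σ i : m.support, Fin (m i) := fun v =>
      ⟨⟨v.1, Finsupp.mem_support_iff.mpr fun h => (Fin.cast h v.2).elim0⟩, v.2⟩
    refine Finite.of_injective f ?_
    rintro ⟨i, a⟩ ⟨j, b⟩ h
    simp only [f, Sigma.mk.injEq, Subtype.mk.injEq] at h
    obtain ⟨rfl, h⟩ := h
    rw [eq_of_heq h]
  exact List.finite_length_eq _ n

lemma symPow_fg (n : ℕ) : (symPow p m n).FG :=
  Submodule.fg_span ((finite_words m n).image _)

lemma one_mem_symPow : (1 : Sym p m) ∈ symPow p m 0 :=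
  Submodule.subset_span ⟨[], by simp, by simp [symWord]⟩

lemma mul_mem_symPow {a b : ℕ} {x y : Sym p m} (hx : x ∈ symPow p m a) (hy : y ∈ symPow p m b) :
    x * y ∈ symPow p m (a + b) := by
  have h := Submodule.mul_mem_mul hx hy
  rw [symPow, symPow, Submodule.span_mul_span] at h
  refine Submodule.span_mono ?_ h
  rintro _ ⟨_, ⟨l, hl, rfl⟩, _, ⟨l', hl', rfl⟩, rfl⟩
  refine ⟨l ++ l', ?_, symWord_append p m l l'⟩
  simp only [Set.mem_ofPred_eq] at hl hl' ⊢
  simp [hl, hl']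

instance symDeg_gradedMonoid : SetLike.GradedMonoid (symDeg p m) where
  one_mem := Submodule.subset_span ⟨[], by simp [wordDeg], by simp [symWord]⟩
  mul_mem i j x y hx hy := by
    have h := Submodule.mul_mem_mul hx hy
    rw [symDeg, symDeg, Submodule.span_mul_span] at h
    refine Submodule.span_mono ?_ h
    rintro _ ⟨_, ⟨l, hl, rfl⟩, _, ⟨l', hl', rfl⟩, rfl⟩
    refine ⟨l ++ l', ?_, symWord_append p m l l'⟩
    simp only [Set.mem_ofPred_eq] at hl hl' ⊢
    rw [wordDeg_append, hl, hl']

lemma symGen_mem (v : Gen m) : symGen p m v ∈ symDeg p m v.1 :=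
  Submodule.subset_span ⟨[v], by simp [wordDeg], by simp [symWord]⟩

lemma symGen_comm (v w : Gen m) :
    symGen p m v * symGen p m w = sgn (p (v.1 * w.1)) • (symGen p m w * symGen p m v) := by
  have h := RingQuot.mkAlgHom_rel ℝ (SymRel.swap (p := p) v w)
  simpa only [symGen, map_mul, map_smul] using h

lemma symWord_mem (l : List (Gen m)) : symWord p m l ∈ symDeg p m (wordDeg m l) :=
  Submodule.subset_span ⟨l, rfl, rfl⟩

/-- The map `S(V) → ⨁ i, S(V)_i` that gives the decomposition into homogeneous components. -/
def symDecomp [DecidableEq I] : Sym p m →ₐ[ℝ] DirectSum I (fun i => symDeg p m i) :=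
  RingQuot.liftAlgHom ℝ ⟨FreeAlgebra.lift ℝ fun v =>
    DirectSum.of (fun i => symDeg p m i) v.1 ⟨symGen p m v, symGen_mem p m v⟩, by
    rintro _ _ ⟨v, w⟩
    simp only [map_mul, map_smul, FreeAlgebra.lift_ι_apply]
    rw [DirectSum.of_mul_of, DirectSum.of_mul_of]
    rw [← DirectSum.lof_eq_of ℝ, ← DirectSum.lof_eq_of ℝ, ← map_smul, DirectSum.lof_eq_of,
      DirectSum.lof_eq_of]
    refine DirectSum.of_eq_of_gradedMonoid_eq ?_
    refine Sigma.subtype_ext (add_comm _ _) ?_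
    exact symGen_comm p m v w⟩

lemma symDecomp_gen [DecidableEq I] (v : Gen m) : symDecomp p m (symGen p m v) =
    DirectSum.of (fun i => symDeg p m i) v.1 ⟨symGen p m v, symGen_mem p m v⟩ := by
  simp [symDecomp, symGen]

lemma symDecomp_word [DecidableEq I] (l : List (Gen m)) : symDecomp p m (symWord p m l) =
    DirectSum.of (fun i => symDeg p m i) (wordDeg m l)
      ⟨symWord p m l, symWord_mem p m l⟩ := by
  induction l with
  | nil =>
    have h : symWord p m [] = 1 := by simp [symWord]
    trans 1
    · rw [h, map_one]
    · refine DirectSum.of_eq_of_gradedMonoid_eq (Sigma.subtype_ext ?_ ?_)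
      · exact (List.sum_nil (α := I)).symm
      · exact h.symm
  | cons v l ih =>
    have h : symWord p m (v :: l) = symGen p m v * symWord p m l := by simp [symWord]
    trans symDecomp p m (symGen p m v) * symDecomp p m (symWord p m l)
    · rw [h, map_mul]
    rw [ih, symDecomp_gen, DirectSum.of_mul_of]
    refine DirectSum.of_eq_of_gradedMonoid_eq (Sigma.subtype_ext ?_ ?_)
    · exact List.sum_cons.symm
    · exact h.symm

/-- The direct sum decomposition `S(V) = ⨁ i, S(V)_i` as an `I`-graded algebra. -/
instance symGradedAlgebra [DecidableEq I] : GradedAlgebra (symDeg p m) :=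
  GradedAlgebra.ofAlgHom (symDeg p m) (symDecomp p m)
    (by
      apply RingQuot.ringQuot_ext' ℝ
      refine FreeAlgebra.hom_ext (funext fun v => ?_)
      change DirectSum.coeAlgHom (symDeg p m) (symDecomp p m (symGen p m v)) = symGen p m v
      rw [symDecomp_gen]
      simp)
    (by
      rintro i ⟨x, hx⟩
      induction hx using Submodule.span_induction with
      | mem x h =>
        obtain ⟨l, rfl, rfl⟩ := h
        exact symDecomp_word p m l
      | zero => simp only [map_zero]; exact (map_zero (DirectSum.of _ i)).symm
      | add x y hx hy h h' =>
        change symDecomp p m x = DirectSum.of _ i (⟨x, hx⟩ : symDeg p m i) at h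
        change symDecomp p m y = DirectSum.of _ i (⟨y, hy⟩ : symDeg p m i) at h'
        change symDecomp p m (x + y) = _
        rw [map_add, h, h', ← map_add]
        rfl
      | smul c x hx h =>
        change symDecomp p m x = DirectSum.of _ i (⟨x, hx⟩ : symDeg p m i) at h
        change symDecomp p m (c • x) = _
        rw [map_smul, h, ← DirectSum.lof_eq_of ℝ, ← map_smul]
        rfl)

open scoped Classical in
/-- The projection of `S(V)` onto its homogeneous component `S(V)_i`. -/
def symProj (i : I) : Sym p m →ₗ[ℝ] Sym p m := GradedAlgebra.proj (symDeg p m) i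

open scoped Classical in
lemma symProj_of_mem (i : I) {x : Sym p m} (hx : x ∈ symDeg p m i) : symProj p m i x = x := by
  rw [symProj, GradedAlgebra.proj_apply]
  exact DirectSum.decompose_of_mem_same _ hx

open scoped Classical in
lemma symProj_of_mem_ne {i j : I} {x : Sym p m} (hx : x ∈ symDeg p m j) (h : j ≠ i) :
    symProj p m i x = 0 := by
  rw [symProj, GradedAlgebra.proj_apply]
  exact DirectSum.decompose_of_mem_ne _ hx h

open scoped Classical in
lemma symProj_mem (i : I) (x : Sym p m) : symProj p m i x ∈ symDeg p m i := by
  rw [symProj, GradedAlgebra.proj_apply]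
  exact SetLike.coe_mem _

lemma symProj_word [DecidableEq I] (i : I) (l : List (Gen m)) :
    symProj p m i (symWord p m l) = if wordDeg m l = i then symWord p m l else 0 := by
  split_ifs with hi
  · subst hi
    exact symProj_of_mem p m _ (symWord_mem p m l)
  · exact symProj_of_mem_ne p m (symWord_mem p m l) hi

lemma symProj_mem_symPow (i : I) {n : ℕ} {x : Sym p m} (hx : x ∈ symPow p m n) :
    symProj p m i x ∈ symPow p m n := by
  classical
  induction hx using Submodule.span_induction with
  | mem x h =>
    obtain ⟨l, hl, rfl⟩ := h
    rw [symProj_word]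
    split_ifs
    · exact Submodule.subset_span ⟨l, hl, rfl⟩
    · exact zero_mem _
  | zero => simp
  | add x y _ _ h h' => rw [map_add]; exact add_mem h h'
  | smul c x _ h => rw [map_smul]; exact Submodule.smul_mem _ c h

lemma symProj_self (i : I) (x : Sym p m) : symProj p m i (symProj p m i x) = symProj p m i x :=
  symProj_of_mem p m i (symProj_mem p m i x)

lemma symProj_ne {i j : I} (h : i ≠ j) (x : Sym p m) : symProj p m i (symProj p m j x) = 0 :=
  symProj_of_mem_ne p m (symProj_mem p m j x) h.symm

lemma symProj_mul (i j : I) {x y : Sym p m} (hx : symProj p m i x = x)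
    (hy : symProj p m j y = y) : symProj p m (i + j) (x * y) = x * y := by
  refine symProj_of_mem p m _ (SetLike.mul_mem_graded ?_ ?_)
  · rw [← hx]; exact symProj_mem p m i x
  · rw [← hy]; exact symProj_mem p m j y

lemma symProj_one : symProj p m 0 1 = 1 :=
  symProj_of_mem p m 0 (SetLike.one_mem_graded (symDeg p m))

/-- Only finitely many degrees occur in `S^n(V)`. -/
lemma exists_degrees (n : ℕ) : ∃ s : Finset I, ∀ x ∈ symPow p m n,
    (∀ i ∉ s, symProj p m i x = 0) ∧ ∑ i ∈ s, symProj p m i x = x := by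
  classical
  refine ⟨((finite_words m n).image (wordDeg m)).toFinset, fun x hx => ?_⟩
  induction hx using Submodule.span_induction with
  | mem x h =>
    obtain ⟨l, hl, rfl⟩ := h
    have hs : wordDeg m l ∈ ((finite_words m n).image (wordDeg m)).toFinset :=
      (Set.Finite.mem_toFinset _).mpr ⟨l, hl, rfl⟩
    refine ⟨fun i hi => ?_, ?_⟩
    · rw [symProj_word, if_neg]
      rintro rfl
      exact hi hs
    · simp_rw [symProj_word]
      rw [Finset.sum_ite_eq, if_pos hs]
  | zero => simp
  | add x y _ _ h h' =>
    refine ⟨fun i hi => by rw [map_add, h.1 i hi, h'.1 i hi, add_zero], ?_⟩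
    simp_rw [map_add]
    rw [Finset.sum_add_distrib, h.2, h'.2]
  | smul c x _ h =>
    refine ⟨fun i hi => by rw [map_smul, h.1 i hi, smul_zero], ?_⟩
    simp_rw [map_smul]
    rw [← Finset.smul_sum, h.2]

end Sym

/-! ### Graded algebras in the completed sense -/

/-- An `I`-grading on a real algebra `A` which, like formal power series algebras, is complete:
`A` is the product of its subspaces `A_i` of homogeneous elements of degree `i`. Here `comp i` is
the projection of `A` onto `A_i`. -/
structure Grading (I : Type w) [AddCommMonoid I] (A : Type u) [Ring A] [Algebra ℝ A] where
  comp : I → A →ₗ[ℝ] A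
  comp_self : ∀ i x, comp i (comp i x) = comp i x
  comp_of_ne : ∀ i j x, i ≠ j → comp i (comp j x) = 0
  existsUnique : ∀ x : I → A, (∀ i, comp i (x i) = x i) → ∃! f : A, ∀ i, comp i f = x i
  one_mem : comp 0 1 = 1
  mul_mem : ∀ i j x y, comp i x = x → comp j y = y → comp (i + j) (x * y) = x * y

/-- The subspace `A_i` of homogeneous elements of degree `i`. -/
def Grading.homog {I : Type w} [AddCommMonoid I] {A : Type u} [Ring A] [Algebra ℝ A]
    (G : Grading I A) (i : I) : Submodule ℝ A := LinearMap.range (G.comp i)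

/-! ### Graded domains -/

section Domain

variable {I : Type w} [NonUnitalCommSemiring I]
variable (p : I →+ ZMod 2) (n : ℕ) (m : I →₀ ℕ)

lemma exists_coord {A : Type w} [AddCommGroup A] [Module ℝ A] (N : Submodule ℝ A) (hN : N.FG) :
    ∃ (k : ℕ) (b : Fin k → A) (c : Fin k → A →ₗ[ℝ] ℝ), ∀ a ∈ N, a = ∑ j, c j a • b j := by
  have : Module.Finite ℝ N := Module.Finite.iff_fg.mpr hN
  let B := Module.finBasis ℝ N
  obtain ⟨π, hπ⟩ := N.subtype.exists_leftInverse_of_injective (by simp)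
  refine ⟨_, fun j => (B j : A), fun j => (B.coord j).comp π, fun a ha => ?_⟩
  have h1 : π a = ⟨a, ha⟩ := LinearMap.congr_fun hπ ⟨a, ha⟩
  have h2 := congrArg N.subtype (B.sum_repr ⟨a, ha⟩)
  simp only [map_sum, map_smul, Submodule.subtype_apply] at h2
  simp only [LinearMap.comp_apply, h1, Module.Basis.coord_apply]
  exact h2.symm

/-- A function with values in the formal power series algebra `∏ k, S^k(V)` is smooth if all its
components, which take values in the finite dimensional spaces `S^k(V)`, are smooth, that is, if
they become smooth real functions when a linear functional is applied. -/
def IsSmooth {W : Opens (EuclideanSpace ℝ (Fin n))} (f : W → PowerSeries (Sym p m)) : Prop :=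
  ∀ k, (∀ x, PowerSeries.coeff k (f x) ∈ symPow p m k) ∧
    ∀ l : Sym p m →ₗ[ℝ] ℝ,
      ContMDiff (𝓡 n) 𝓘(ℝ, ℝ) ∞ (fun x : W => l (PowerSeries.coeff k (f x)))

/-- The algebra of smooth functions on `W` with values in the formal power series
algebra `∏ k, S^k(V)`. A family `(s_k)` with `s_k ∈ S^k(V)` is encoded as the power series
`∑ s_k X^k` over `S(V)`, so that the multiplication is the canonical one. -/
def domAlg (W : Opens (EuclideanSpace ℝ (Fin n))) :
    Subalgebra ℝ (W → PowerSeries (Sym p m)) where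
  carrier := {f | IsSmooth p n m f}
  add_mem' {f g} hf hg k := by
    refine ⟨fun x => ?_, fun l => ?_⟩
    · simpa using add_mem ((hf k).1 x) ((hg k).1 x)
    · simp only [Pi.add_apply, map_add]
      exact ((hf k).2 l).add ((hg k).2 l)
  mul_mem' {f g} hf hg k := by
    refine ⟨fun x => ?_, fun l => ?_⟩
    · simp only [Pi.mul_apply, PowerSeries.coeff_mul]
      refine sum_mem fun q hq => ?_
      rw [← Finset.HasAntidiagonal.mem_antidiagonal.mp hq]
      exact mul_mem_symPow p m ((hf _).1 x) ((hg _).1 x)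
    · simp only [Pi.mul_apply, PowerSeries.coeff_mul, map_sum]
      refine contMDiff_finsetSum fun q _ => ?_
      obtain ⟨a, b, c, h⟩ := exists_coord _ (symPow_fg p m q.1)
      obtain ⟨a', b', c', h'⟩ := exists_coord _ (symPow_fg p m q.2)
      have key : ∀ x, l (PowerSeries.coeff q.1 (f x) * PowerSeries.coeff q.2 (g x)) =
          ∑ j, ∑ j', c j (PowerSeries.coeff q.1 (f x)) * c' j' (PowerSeries.coeff q.2 (g x)) *
            l (b j * b' j') := fun x => by
        conv_lhs => rw [h _ ((hf q.1).1 x), h' _ ((hg q.2).1 x)]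
        simp only [Finset.sum_mul_sum, map_sum, smul_mul_smul_comm, map_smul, smul_eq_mul]
      simp only [key]
      refine contMDiff_finsetSum fun j _ => contMDiff_finsetSum fun j' _ => ?_
      exact (((hf q.1).2 (c j)).mul ((hg q.2).2 (c' j'))).mul contMDiff_const
  algebraMap_mem' r k := by
    refine ⟨fun x => ?_, fun l => contMDiff_const (c := l (PowerSeries.coeff k (algebraMap ℝ _ r)))⟩
    simp only [Pi.algebraMap_apply, Algebra.algebraMap_eq_smul_one, PowerSeries.coeff_smul,
      PowerSeries.coeff_one]
    split_ifs with hk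
    · subst hk
      exact Submodule.smul_mem _ _ (one_mem_symPow p m)
    · simp

/-- Restriction of smooth functions. -/
def domRes {W W' : Opens (EuclideanSpace ℝ (Fin n))} (h : W' ≤ W) :
    domAlg p n m W →ₐ[ℝ] domAlg p n m W' where
  toFun f := ⟨fun x => f.1 ⟨x.1, h x.2⟩, fun k =>
    ⟨fun _ => (f.2 k).1 _, fun l => ((f.2 k).2 l).comp (contMDiff_inclusion h)⟩⟩
  map_one' := rfl
  map_mul' _ _ := rfl
  map_zero' := rfl
  map_add' _ _ := rfl
  commutes' _ := rfl

/-- The projection of `domAlg` onto homogeneous functions of degree `i`. -/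
def domComp (W : Opens (EuclideanSpace ℝ (Fin n))) (i : I) :
    domAlg p n m W →ₗ[ℝ] domAlg p n m W where
  toFun f := ⟨fun x => PowerSeries.mk fun k => symProj p m i (PowerSeries.coeff k (f.1 x)),
    fun k => by
      simp only [PowerSeries.coeff_mk]
      exact ⟨fun x => symProj_mem_symPow p m i ((f.2 k).1 x),
        fun l => (f.2 k).2 (l.comp (symProj p m i))⟩⟩
  map_add' f g := by
    refine Subtype.ext (funext fun x => PowerSeries.ext fun k => ?_)
    simp
  map_smul' c f := by
    refine Subtype.ext (funext fun x => PowerSeries.ext fun k => ?_)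
    simp

lemma coeff_domComp (W : Opens (EuclideanSpace ℝ (Fin n))) (i : I) (f : domAlg p n m W) (x : W)
    (k : ℕ) : PowerSeries.coeff k ((domComp p n m W i f).1 x) =
      symProj p m i (PowerSeries.coeff k (f.1 x)) := by
  simp [domComp]

lemma domAlg_ext {W : Opens (EuclideanSpace ℝ (Fin n))} {f g : domAlg p n m W}
    (h : ∀ x k, PowerSeries.coeff k (f.1 x) = PowerSeries.coeff k (g.1 x)) : f = g :=
  Subtype.ext (funext fun x => PowerSeries.ext fun k => h x k)

/-- The grading of the algebra of functions on a graded domain. -/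
def domGrading (W : Opens (EuclideanSpace ℝ (Fin n))) : Grading I (domAlg p n m W) where
  comp := domComp p n m W
  comp_self i f := domAlg_ext p n m fun x k => by
    simp only [coeff_domComp, symProj_self]
  comp_of_ne i j f h := domAlg_ext p n m fun x k => by
    rw [coeff_domComp, coeff_domComp, symProj_ne p m h]
    simp
  existsUnique f hf := by
    have hf' : ∀ i x k, symProj p m i (PowerSeries.coeff k ((f i).1 x)) =
        PowerSeries.coeff k ((f i).1 x) := fun i x k => by
      rw [← coeff_domComp, hf]
    choose s hs using exists_degrees p m
    refine ⟨⟨fun x => PowerSeries.mk fun k => ∑ i ∈ s k, PowerSeries.coeff k ((f i).1 x),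
      fun k => ?_⟩, fun j => domAlg_ext p n m fun x k => ?_, fun g hg =>
      domAlg_ext p n m fun x k => ?_⟩
    · simp only [PowerSeries.coeff_mk, map_sum]
      exact ⟨fun x => sum_mem fun i _ => ((f i).2 k).1 x,
        fun l => contMDiff_finsetSum fun i _ => ((f i).2 k).2 l⟩
    · rw [coeff_domComp]
      simp only [PowerSeries.coeff_mk, map_sum]
      by_cases hj : j ∈ s k
      · rw [Finset.sum_eq_single_of_mem j hj, hf']
        intro i _ hij
        rw [← hf' i x k, symProj_ne p m hij.symm]
      · rw [← hf' j x k, (hs k _ (((f j).2 k).1 x)).1 j hj]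
        refine Finset.sum_eq_zero fun i hi => ?_
        rw [← hf' i x k, symProj_ne p m]
        rintro rfl
        exact hj hi
    · simp only [PowerSeries.coeff_mk]
      rw [← (hs k _ ((g.2 k).1 x)).2]
      refine Finset.sum_congr rfl fun i _ => ?_
      rw [← coeff_domComp, hg]
  one_mem := domAlg_ext p n m fun x k => by
    rw [coeff_domComp]
    simp only [OneMemClass.coe_one, Pi.one_apply, PowerSeries.coeff_one]
    split_ifs
    · exact symProj_one p m
    · simp
  mul_mem i j f g hf hg := domAlg_ext p n m fun x k => by
    rw [coeff_domComp]
    simp only [MulMemClass.coe_mul, Pi.mul_apply, PowerSeries.coeff_mul, map_sum]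
    refine Finset.sum_congr rfl fun q _ => symProj_mul p m i j ?_ ?_
    · rw [← coeff_domComp, hf]
    · rw [← coeff_domComp, hg]

end Domain

/-! ### Graded ringed spaces and graded manifolds -/

section Manifold

variable {I : Type w} [NonUnitalCommSemiring I]

/-- A sheaf of real algebras on `X` with compatible `I`-gradings of its algebras of sections. -/
structure GradedRingedSpace (I : Type w) [NonUnitalCommSemiring I] (X : TopCat.{u}) where
  sheaf : TopCat.Sheaf (AlgCat.{u} ℝ) X
  grading : ∀ U : Opens X, Grading I (sheaf.presheaf.obj (op U))
  comp_map : ∀ {U V : Opens X} (h : V ≤ U) (i : I) (f : sheaf.presheaf.obj (op U)),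
    (grading V).comp i ((sheaf.presheaf.map (homOfLE h).op).hom f) =
      (sheaf.presheaf.map (homOfLE h).op).hom ((grading U).comp i f)

namespace GradedRingedSpace

variable {X : TopCat.{u}} (O : GradedRingedSpace I X)

/-- The algebra of sections over `U`. -/
abbrev Sec (U : Opens X) : Type u := O.sheaf.presheaf.obj (op U)

/-- The restriction morphism. -/
def res {U V : Opens X} (h : V ≤ U) : O.Sec U →ₐ[ℝ] O.Sec V :=
  (O.sheaf.presheaf.map (homOfLE h).op).hom

/-- The homogeneous sections of degree `i` over `U`. -/
abbrev homog (U : Opens X) (i : I) : Submodule ℝ (O.Sec U) := (O.grading U).homog i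

end GradedRingedSpace

/-- The part of the source of a partial homeomorphism that is mapped to `W`. -/
def pullOpen {X : TopCat.{u}} {n : ℕ} (e : OpenPartialHomeomorph X (EuclideanSpace ℝ (Fin n)))
    (W : Opens (EuclideanSpace ℝ (Fin n))) : Opens X :=
  ⟨e.source ∩ e ⁻¹' W, e.isOpen_inter_preimage W.isOpen⟩

lemma pullOpen_mono {X : TopCat.{u}} {n : ℕ}
    (e : OpenPartialHomeomorph X (EuclideanSpace ℝ (Fin n)))
    {W W' : Opens (EuclideanSpace ℝ (Fin n))} (h : W' ≤ W) : pullOpen e W' ≤ pullOpen e W :=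
  fun _ hx => ⟨hx.1, h hx.2⟩

/-- A chart: a homeomorphism of an open subset of `X` onto an open subset of `ℝ ^ n`, together
with an isomorphism of sheaves of `I`-graded algebras with the structure sheaf of the
graded domain. -/
structure Chart {X : TopCat.{u}} (O : GradedRingedSpace I X) (p : I →+ ZMod 2) (n : ℕ)
    (m : I →₀ ℕ) where
  homeo : OpenPartialHomeomorph X (EuclideanSpace ℝ (Fin n))
  iso : ∀ W : Opens (EuclideanSpace ℝ (Fin n)),
    (W : Set (EuclideanSpace ℝ (Fin n))) ⊆ homeo.target →
    (O.Sec (pullOpen homeo W) ≃ₐ[ℝ] domAlg p n m W)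
  iso_comp : ∀ W hW i f, iso W hW ((O.grading _).comp i f) = (domGrading p n m W).comp i (iso W hW f)
  iso_res : ∀ {W W' : Opens (EuclideanSpace ℝ (Fin n))} (h : W' ≤ W) hW hW' f,
    iso W' hW' (O.res (pullOpen_mono homeo h) f) = domRes p n m h (iso W hW f)

/-- An `I`-graded manifold of dimension `n | (m i)` over `X`, where `V_0 = 0`. The charts make `X`
locally Euclidean of dimension `n`; its smooth structure is the one determined by the sheaf. -/
structure GradedManifold (p : I →+ ZMod 2) (n : ℕ) (m : I →₀ ℕ) (X : TopCat.{u})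
    extends GradedRingedSpace I X where
  dim_zero : m 0 = 0
  exists_chart : ∀ x : X, ∃ c : Chart toGradedRingedSpace p n m, x ∈ c.homeo.source

end Manifold

/-! ### Vector fields -/

section VectorFields

variable {I : Type w} [NonUnitalCommSemiring I] {X : TopCat.{u}}

/-- Derivations `D` of degree `α ∈ K(I)` of the graded algebra `O(U)`: linear endomorphisms with
`D (O(U)_i) ⊆ O(U)_j` whenever `j - i = α` in `K(I)`, with `D (O(U)_i) = 0` if there is no such `j`,
and with `D (f g) = D(f) g + (-1) ^ p (α d(f)) f D(g)` for homogeneous `f` and arbitrary `g`. -/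
def homDer (p : I →+ ZMod 2) (O : GradedRingedSpace I X) (U : Opens X) (α : GK I) :
    Submodule ℝ (Module.End ℝ (O.Sec U)) where
  carrier := {D |
    (∀ i j, toGK j = α + toGK i → ∀ f ∈ O.homog U i, D f ∈ O.homog U j) ∧
    (∀ i, (∀ j, toGK j ≠ α + toGK i) → ∀ f ∈ O.homog U i, D f = 0) ∧
    ∀ i, ∀ f ∈ O.homog U i, ∀ g, D (f * g) = D f * g + sgn (parityMul p α i) • (f * D g)}
  add_mem' {D E} hD hE := by
    refine ⟨fun i j h f hf => add_mem (hD.1 i j h f hf) (hE.1 i j h f hf), fun i h f hf => ?_,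
      fun i f hf g => ?_⟩
    · rw [LinearMap.add_apply, hD.2.1 i h f hf, hE.2.1 i h f hf, add_zero]
    · simp only [LinearMap.add_apply, hD.2.2 i f hf g, hE.2.2 i f hf g, add_mul, mul_add, smul_add]
      abel
  zero_mem' := by
    refine ⟨fun _ _ _ _ _ => zero_mem _, fun _ _ _ _ => rfl, fun _ _ _ _ => ?_⟩
    simp
  smul_mem' c D hD := by
    refine ⟨fun i j h f hf => Submodule.smul_mem _ c (hD.1 i j h f hf), fun i h f hf => ?_,
      fun i f hf g => ?_⟩
    · rw [LinearMap.smul_apply, hD.2.1 i h f hf, smul_zero]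
    · simp only [LinearMap.smul_apply, hD.2.2 i f hf g, smul_add, smul_mul_assoc, mul_smul_comm]
      rw [smul_comm]

/-- `D'` is the restriction to `V` of the endomorphism `D` of `O(U)`. -/
def IsRestriction (O : GradedRingedSpace I X) {U V : Opens X} (h : V ≤ U)
    (D : Module.End ℝ (O.Sec U)) (D' : Module.End ℝ (O.Sec V)) : Prop :=
  ∀ f, D' (O.res h f) = O.res h (D f)

/-- The structure of a presheaf on vector fields given by restricting derivations. -/
structure Restrictions (p : I →+ ZMod 2) (O : GradedRingedSpace I X) where
  map : ∀ {U V : Opens X}, V ≤ U → ∀ α : GK I, homDer p O U α →ₗ[ℝ] homDer p O V α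
  isRestriction : ∀ {U V : Opens X} (h : V ≤ U) α (D : homDer p O U α),
    IsRestriction O h D.1 (map h α D).1
  map_id : ∀ (U : Opens X) α, map (le_refl U) α = LinearMap.id
  map_comp : ∀ {U V W : Opens X} (h : V ≤ U) (h' : W ≤ V) α,
    map (h'.trans h) α = (map h' α).comp (map h α)

namespace Restrictions

variable {p : I →+ ZMod 2} {O : GradedRingedSpace I X} (R : Restrictions p O)

/-- The presheaf of vector fields of degree `α`. -/
def presheafDeg (α : GK I) : TopCat.Presheaf (ModuleCat.{u} ℝ) X where
  obj U := ModuleCat.of ℝ (homDer p O U.unop α)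
  map f := ModuleCat.ofHom (R.map (leOfHom f.unop) α)
  map_id U := by
    rw [R.map_id]
    rfl
  map_comp f g := by
    rw [← ModuleCat.ofHom_comp, ← R.map_comp]

/-- The presheaf `𝔛` of all vector fields. In accordance with the convention for gradings, `𝔛(U)` is
the product of the spaces `𝔛(U)_α` of derivations of degree `α` of `O(U)`, for `α ∈ K(I)`: a vector
field is the (possibly infinite) sum `∑ α, D α` of its homogeneous components. -/
def presheaf : TopCat.Presheaf (ModuleCat.{max u w} ℝ) X where
  obj U := ModuleCat.of ℝ (∀ α : GK I, homDer p O U.unop α)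
  map f := ModuleCat.ofHom (LinearMap.pi fun α => (R.map (leOfHom f.unop) α).comp
    (LinearMap.proj α))
  map_id U := by
    simp only [R.map_id]
    rfl
  map_comp f g := by
    rw [← ModuleCat.ofHom_comp]
    congr 1
    refine LinearMap.ext fun D => funext fun α => ?_
    exact LinearMap.congr_fun (R.map_comp (leOfHom f.unop) (leOfHom g.unop) α) (D α)

end Restrictions

end VectorFields

end MonGraded

end

/-! Restriction `O(U) → O(V)` need not be surjective, so a derivation of `O(U)` does not determine
an operator on `O(V)` by a formula. As on ordinary manifolds, bump functions repair this. The charts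
and the Hausdorff property give sections of degree `0` that are `1` near a point and vanish away
from it (`GradedManifold.hasBumps`). This is the only input from the manifold structure: the rest
holds for every graded ringed space satisfying `HasBumps`.

Multiplying by a bump and extending by zero shows that a section over `V` agrees near each point
with the restriction of a section over `U` (`HasBumps.exists_extension`). A bump has degree `0`, so
the Leibniz rule for it carries no sign, and the classical argument shows that derivations are local
(`homDer_local`). Hence `D' g` must be `D G` near `x` for any extension `G` of `g` near `x`. This
gives uniqueness, and it also gives existence, since these local values glue (`exists_restriction`).

Functoriality follows from uniqueness. For the sheaf property, compatible derivations are glued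
value by value in `O`; the degree conditions and the Leibniz rule can be checked locally
(`mem_homDer_of_locally`). The product over all degrees is glued componentwise. -/

noncomputable section

namespace MonGraded

/-! ### Locality, gluing and homogeneity of sections; extension by bump functions. -/

section Sections

variable {I : Type w} [NonUnitalCommSemiring I] {X : TopCat.{u}}

namespace GradedRingedSpace

variable (O : GradedRingedSpace I X)

lemma res_res {U V W : Opens X} (h : V ≤ U) (h' : W ≤ V) (f : O.Sec U) :
    O.res h' (O.res h f) = O.res (h'.trans h) f := by
  have : (homOfLE (h'.trans h)).op = (homOfLE h).op ≫ (homOfLE h').op := rfl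
  simp only [res, this, Functor.map_comp, AlgCat.hom_comp, AlgHom.comp_apply]

lemma res_self {U : Opens X} (f : O.Sec U) : O.res le_rfl f = f := by
  have : (homOfLE (le_refl U)).op = 𝟙 (op U) := rfl
  simp only [res, this, CategoryTheory.Functor.map_id, AlgCat.hom_id, AlgHom.id_apply]

variable {O}

lemma eq_of_cover {ι : Type*} {U : Opens X} (V : ι → Opens X) (hV : ∀ i, V i ≤ U)
    (hc : U ≤ iSup V) {f g : O.Sec U} (H : ∀ i, O.res (hV i) f = O.res (hV i) g) : f = g :=
  O.sheaf.eq_of_locally_eq' V U (fun i => homOfLE (hV i)) hc f g H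

lemma eq_of_locally_eq {U : Opens X} {f g : O.Sec U}
    (H : ∀ x ∈ U, ∃ (V : Opens X) (h : V ≤ U), x ∈ V ∧ O.res h f = O.res h g) : f = g := by
  choose V h hx e using fun x : U => H x.1 x.2
  exact eq_of_cover V h (fun x hxU => Opens.mem_iSup.2 ⟨⟨x, hxU⟩, hx _⟩) e

lemma exists_glue {ι : Type*} {U : Opens X} (V : ι → Opens X) (hV : ∀ i, V i ≤ U)
    (hc : U ≤ iSup V) (s : ∀ i, O.Sec (V i))
    (hs : ∀ i j, O.res (inf_le_left : V i ⊓ V j ≤ V i) (s i) =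
      O.res (inf_le_right : V i ⊓ V j ≤ V j) (s j)) :
    ∃ f : O.Sec U, ∀ i, O.res (hV i) f = s i :=
  (O.sheaf.existsUnique_gluing' V U (fun i => homOfLE (hV i)) hc s hs).exists

/-- The two-set case of gluing, used for extension by zero. -/
lemma exists_glue₂ {U V W : Opens X} (hV : V ≤ U) (hW : W ≤ U) (hc : U ≤ V ⊔ W)
    (f : O.Sec V) (g : O.Sec W)
    (hfg : O.res (inf_le_left : V ⊓ W ≤ V) f = O.res inf_le_right g) :
    ∃ s : O.Sec U, O.res hV s = f ∧ O.res hW s = g := by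
  obtain ⟨s, hs⟩ := exists_glue (O := O) (U := U) (fun b : Bool => cond b V W)
    (fun b => by cases b <;> assumption)
    (hc.trans (sup_le (le_iSup (fun b : Bool => cond b V W) true)
      (le_iSup (fun b : Bool => cond b V W) false)))
    (fun b => match b with
      | true => f
      | false => g)
    (fun b c => by
      cases b <;> cases c
      · rfl
      · have := congrArg (O.res (inf_comm W V).le) hfg
        rw [res_res, res_res] at this
        exact this.symm
      · exact hfg
      · rfl)
  exact ⟨s, hs true, hs false⟩

lemma mem_homog_iff {U : Opens X} {i : I} {f : O.Sec U} :
    f ∈ O.homog U i ↔ (O.grading U).comp i f = f := by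
  constructor
  · rintro ⟨g, rfl⟩
    exact (O.grading U).comp_self i g
  · exact fun h => ⟨f, h⟩

lemma comp_res {U V : Opens X} (h : V ≤ U) (i : I) (f : O.Sec U) :
    (O.grading V).comp i (O.res h f) = O.res h ((O.grading U).comp i f) :=
  O.comp_map h i f

lemma res_mem_homog {U V : Opens X} (h : V ≤ U) {i : I} {f : O.Sec U} (hf : f ∈ O.homog U i) :
    O.res h f ∈ O.homog V i := by
  rw [mem_homog_iff] at hf ⊢
  rw [comp_res, hf]

/-- Projections commute with restriction, so `comp i f = f` is an identity of sections that can be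
checked locally. -/
lemma mem_homog_of_locally {U : Opens X} {i : I} {f : O.Sec U}
    (H : ∀ x ∈ U, ∃ (V : Opens X) (h : V ≤ U), x ∈ V ∧ O.res h f ∈ O.homog V i) :
    f ∈ O.homog U i := by
  rw [mem_homog_iff]
  refine eq_of_locally_eq fun x hx => ?_
  obtain ⟨V, h, hxV, hV⟩ := H x hx
  exact ⟨V, h, hxV, by rw [← comp_res, mem_homog_iff.1 hV]⟩

lemma mul_mem_homog {U : Opens X} {i j : I} {f g : O.Sec U} (hf : f ∈ O.homog U i)
    (hg : g ∈ O.homog U j) : f * g ∈ O.homog U (i + j) := by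
  rw [mem_homog_iff] at *
  exact (O.grading U).mul_mem i j f g hf hg

variable (O) in
/-- Every open neighbourhood `V` of a point `x` supports a global section of degree `0` which is `1`
near `x` and vanishes on an open set `Z` that covers `X` together with `V`. -/
def HasBumps : Prop :=
  ∀ (V : Opens X), ∀ x ∈ V, ∃ b ∈ O.homog ⊤ 0, ∃ W Z : Opens X, x ∈ W ∧ W ≤ V ∧ V ⊔ Z = ⊤ ∧
    O.res (le_top : W ≤ ⊤) b = 1 ∧ O.res (le_top : Z ≤ ⊤) b = 0

/-- A section over `V` can be extended, near a given point, to any larger open set. -/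
lemma HasBumps.exists_extension (hO : O.HasBumps) {U V : Opens X} (h : V ≤ U) {x : X} (hx : x ∈ V)
    (g : O.Sec V) : ∃ (W : Opens X) (hW : W ≤ V) (G : O.Sec U), x ∈ W ∧
      O.res (hW.trans h) G = O.res hW g ∧ ∀ i, g ∈ O.homog V i → G ∈ O.homog U i := by
  obtain ⟨b, hb, W, Z, hxW, hWV, hVZ, hbW, hbZ⟩ := hO V x hx
  have hc : U ≤ V ⊔ (U ⊓ Z) := by
    rw [sup_inf_left, hVZ, inf_top_eq]
    exact le_sup_right
  -- Extension of `b * g` by zero: the overlap lies in `Z`, where `b` vanishes. Since `b` has degree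
  -- `0`, the product keeps the degree of `g`.
  obtain ⟨G, hGV, hGZ⟩ := exists_glue₂ (O := O) h (inf_le_left : U ⊓ Z ≤ U) hc
    (O.res le_top b * g) 0 (by
      have hZ : V ⊓ (U ⊓ Z) ≤ Z := inf_le_right.trans inf_le_right
      rw [map_mul, res_res, ← res_res O le_top hZ, hbZ, map_zero, map_zero, zero_mul])
  refine ⟨W, hWV, G, hxW, ?_, fun i hi => mem_homog_of_locally fun y hy => ?_⟩
  · rw [← res_res O h hWV, hGV, map_mul, res_res, hbW, one_mul]
  · rcases hc hy with hyV | hyZ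
    · refine ⟨V, h, hyV, ?_⟩
      rw [hGV, ← zero_add i]
      exact mul_mem_homog (res_mem_homog _ hb) hi
    · refine ⟨U ⊓ Z, inf_le_left, hyZ, ?_⟩
      rw [hGZ]
      exact zero_mem _

end GradedRingedSpace

end Sections

/-! ### Bump functions on graded manifolds -/

section Bumps

variable {I : Type w} [NonUnitalCommSemiring I]

/-- A smooth real function, as an element of the algebra of functions on a graded domain. -/
def smoothFun (p : I →+ ZMod 2) {n : ℕ} (m : I →₀ ℕ) (W : Opens (EuclideanSpace ℝ (Fin n)))
    {f : EuclideanSpace ℝ (Fin n) → ℝ} (hf : ContDiff ℝ ∞ f) : domAlg p n m W :=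
  ⟨fun x => algebraMap ℝ _ (f x), fun k => by
    simp only [Algebra.algebraMap_eq_smul_one, PowerSeries.coeff_smul, PowerSeries.coeff_one]
    split_ifs with hk
    · subst hk
      refine ⟨fun x => Submodule.smul_mem _ _ (one_mem_symPow p m), fun l => ?_⟩
      simp only [map_smul, smul_eq_mul]
      exact (hf.contMDiff.comp contMDiff_subtype_val).mul contMDiff_const
    · simp only [smul_zero, map_zero]
      exact ⟨fun _ => zero_mem _, fun l => contMDiff_const⟩⟩

lemma domComp_smoothFun (p : I →+ ZMod 2) {n : ℕ} (m : I →₀ ℕ)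
    (W : Opens (EuclideanSpace ℝ (Fin n))) {f : EuclideanSpace ℝ (Fin n) → ℝ}
    (hf : ContDiff ℝ ∞ f) : domComp p n m W 0 (smoothFun p m W hf) = smoothFun p m W hf := by
  refine domAlg_ext p n m fun x k => ?_
  rw [coeff_domComp]
  simp only [smoothFun, Algebra.algebraMap_eq_smul_one, PowerSeries.coeff_smul,
    PowerSeries.coeff_one]
  split_ifs
  · rw [map_smul, symProj_one]
  · simp

/-- Graded manifolds have bump functions. -/
lemma GradedManifold.hasBumps {p : I →+ ZMod 2} {n : ℕ} {m : I →₀ ℕ} {X : TopCat.{u}} [T2Space X]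
    (M : GradedManifold p n m X) : M.toGradedRingedSpace.HasBumps := by
  intro V x hx
  obtain ⟨c, hxc⟩ := M.exists_chart x
  let e := c.homeo
  have hopen : IsOpen (e.target ∩ e.symm ⁻¹' (V : Set X)) := e.isOpen_inter_preimage_symm V.isOpen
  obtain ⟨r, hr, hball⟩ := Metric.isOpen_iff.1 hopen (e x)
    ⟨e.map_source hxc, by simpa [e.left_inv hxc] using hx⟩
  -- `φ` is `1` on the ball of radius `r / 4` and `0` at distance at least `r / 2`. The slack
  -- between `r / 2` and `r` puts the closed ball `K` inside the open set on which the inverse chart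
  -- lands in `V`.
  let φ : ContDiffBump (e x) := ⟨r / 4, r / 2, by positivity, by linarith⟩
  have hφ : ContDiff ℝ ∞ φ := φ.contDiff
  let K : Set (EuclideanSpace ℝ (Fin n)) := Metric.closedBall (e x) (r / 2)
  have hK : K ⊆ e.target ∩ e.symm ⁻¹' (V : Set X) :=
    (Metric.closedBall_subset_ball (by linarith)).trans hball
  -- The Hausdorff property enters here: the image of `K` is compact, hence closed in all of `X` and
  -- not just in the chart domain.
  have hKc : IsClosed (e.symm '' K) :=
    ((isCompact_closedBall _ _).image_of_continuousOn
      (e.continuousOn_symm.mono fun y hy => (hK hy).1)).isClosed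
  let T : Opens (EuclideanSpace ℝ (Fin n)) := ⟨e.target, e.open_target⟩
  let Z : Opens X := ⟨(e.symm '' K)ᶜ, hKc.isOpen_compl⟩
  let TK : Opens (EuclideanSpace ℝ (Fin n)) :=
    ⟨e.target \ K, e.open_target.sdiff Metric.isClosed_closedBall⟩
  let B : Opens (EuclideanSpace ℝ (Fin n)) := ⟨Metric.ball (e x) (r / 4), Metric.isOpen_ball⟩
  have hBK : (B : Set _) ⊆ K := Metric.ball_subset_closedBall.trans
    (Metric.closedBall_subset_closedBall (by linarith))
  have hBT : B ≤ T := fun y hy => (hK (hBK hy)).1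
  have hTK : TK ≤ T := fun y hy => hy.1
  -- On this overlap the chart takes values in the target minus `K`, where `φ` vanishes, so `b₀`
  -- agrees there with the zero section over `Z`.
  have hZ : pullOpen e T ⊓ Z ≤ pullOpen e TK := fun y hy =>
    ⟨hy.1.1, hy.1.2, fun hyK => hy.2 ⟨e y, hyK, e.left_inv hy.1.1⟩⟩
  have hcov : (⊤ : Opens X) ≤ pullOpen e T ⊔ Z := by
    intro y _
    by_cases hy : y ∈ e.symm '' K
    · obtain ⟨z, hz, rfl⟩ := hy
      exact Or.inl ⟨e.map_target (hK hz).1, e.map_source (e.map_target (hK hz).1)⟩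
    · exact Or.inr hy
  let b₀ : M.Sec (pullOpen e T) := (c.iso T subset_rfl).symm (smoothFun p m T hφ)
  have hb₀ : c.iso T subset_rfl b₀ = smoothFun p m T hφ := AlgEquiv.apply_symm_apply _ _
  have hb₀0 : b₀ ∈ M.homog (pullOpen e T) 0 := by
    rw [GradedRingedSpace.mem_homog_iff]
    apply (c.iso T subset_rfl).injective
    rw [c.iso_comp, hb₀]
    exact domComp_smoothFun p m T hφ
  have hb₀TK : M.res (pullOpen_mono e hTK) b₀ = 0 := by
    have hT : (TK : Set _) ⊆ c.homeo.target := Set.sdiff_subset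
    apply (c.iso TK hT).injective
    refine (c.iso_res hTK subset_rfl hT b₀).trans ?_
    rw [hb₀, map_zero]
    refine Subtype.ext (funext fun y => ?_)
    have : φ y.1 = 0 := φ.zero_of_le_dist (not_lt.1 fun h => y.2.2 h.le)
    change algebraMap ℝ (PowerSeries (Sym p m)) (φ y.1) = 0
    rw [this, map_zero]
  have hb₀B : M.res (pullOpen_mono e hBT) b₀ = 1 := by
    have hT : (B : Set _) ⊆ c.homeo.target := hBT
    apply (c.iso B hT).injective
    refine (c.iso_res hBT subset_rfl hT b₀).trans ?_
    rw [hb₀, map_one]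
    refine Subtype.ext (funext fun y => ?_)
    have : φ y.1 = 1 := φ.one_of_mem_closedBall (Metric.ball_subset_closedBall y.2)
    change algebraMap ℝ (PowerSeries (Sym p m)) (φ y.1) = 1
    rw [this, map_one]
  obtain ⟨b, hb, hbZ⟩ := GradedRingedSpace.exists_glue₂ (O := M.toGradedRingedSpace)
    (U := ⊤) le_top le_top hcov b₀ (0 : M.Sec Z) (by
      rw [map_zero, ← M.res_res (pullOpen_mono e hTK) hZ, hb₀TK, map_zero])
  refine ⟨b, GradedRingedSpace.mem_homog_of_locally fun y _ => ?_, pullOpen e B, Z, ?_, ?_, ?_, ?_,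
    hbZ⟩
  · rcases hcov (Opens.mem_top y) with hy | hy
    · exact ⟨_, le_top, hy, by rw [hb]; exact hb₀0⟩
    · exact ⟨_, le_top, hy, by rw [hbZ]; exact zero_mem _⟩
  · exact ⟨hxc, Metric.mem_ball_self (by positivity)⟩
  · intro y hy
    have := (hK (hBK hy.2)).2
    rwa [Set.mem_preimage, e.left_inv hy.1] at this
  · refine top_le_iff.1 fun y _ => ?_
    by_cases hy : y ∈ e.symm '' K
    · obtain ⟨z, hz, rfl⟩ := hy
      exact Or.inl (hK hz).2
    · exact Or.inr hy
  · rw [← M.res_res le_top (pullOpen_mono e hBT), hb, hb₀B]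

end Bumps

/-! ### Derivations are local -/

section Local

variable {I : Type w} [NonUnitalCommSemiring I] {X : TopCat.{u}}
variable {p : I →+ ZMod 2} {O : GradedRingedSpace I X}

/-- Makes the Leibniz sign trivial when the first factor is a bump. A homomorphism on the
Grothendieck group is determined on `I`, where `p (j * 0) = 0`. -/
lemma parityMul_zero_right (α : GK I) : parityMul p α 0 = 0 := by
  have h : p.comp (AddMonoidHom.mulRight (0 : I)) = (0 : GK I →+ ZMod 2).comp toGK := by
    ext i
    simp
  rw [parityMul, h]
  exact DFunLike.congr_fun
    (Algebra.GrothendieckAddGroup.lift.apply_symm_apply (0 : GK I →+ ZMod 2)) α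

open GradedRingedSpace

/-- By linearity, let `f` vanish on `V`. With a bump `b` supported in `V`, `b f = 0`, so `0 = D(b) f
+ b D(f)`; near `x`, where `f = 0` and `b = 1`, this reads `D f = 0`. -/
lemma homDer_local (hO : O.HasBumps) {U V : Opens X} (h : V ≤ U) {α : GK I}
    {D : Module.End ℝ (O.Sec U)} (hD : D ∈ homDer p O U α) {f g : O.Sec U}
    (hfg : O.res h f = O.res h g) : O.res h (D f) = O.res h (D g) := by
  suffices H : ∀ f : O.Sec U, O.res h f = 0 → O.res h (D f) = 0 by
    have := H (f - g) (by rw [map_sub, hfg, sub_self])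
    rwa [map_sub, map_sub, sub_eq_zero] at this
  intro f hf
  refine eq_of_locally_eq fun x hx => ?_
  obtain ⟨b, hb, W, Z, hxW, hWV, hVZ, hbW, hbZ⟩ := hO V x hx
  refine ⟨W, hWV, hxW, ?_⟩
  have hbf : O.res le_top b * f = 0 := by
    refine eq_of_locally_eq fun y hy => ?_
    rcases (hVZ ▸ Opens.mem_top y : y ∈ V ⊔ Z) with hyV | hyZ
    · exact ⟨V, h, hyV, by rw [map_mul, hf, mul_zero, map_zero]⟩
    · refine ⟨U ⊓ Z, inf_le_left, ⟨hy, hyZ⟩, ?_⟩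
      rw [map_mul, res_res, ← res_res O le_top inf_le_right, hbZ, map_zero, zero_mul, map_zero]
  have hL := hD.2.2 0 _ (res_mem_homog (le_top : U ≤ ⊤) hb) f
  rw [hbf, map_zero, parityMul_zero_right] at hL
  have := congrArg (O.res (hWV.trans h)) hL
  rw [map_zero, map_add, map_mul, map_smul, map_mul, res_res, hbW, one_mul,
    ← res_res O h hWV f, hf, map_zero, mul_zero, zero_add] at this
  rw [res_res, map_zero]
  simpa [sgn] using this.symm

/-- By locality of `D'`, its value near a point is dictated by `D` on any extension; together with
the existence of extensions this forces uniqueness. -/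
lemma IsRestriction.res_eq (hO : O.HasBumps) {U V W : Opens X} (h : V ≤ U) (hW : W ≤ V) {α : GK I}
    {D : Module.End ℝ (O.Sec U)} {D' : Module.End ℝ (O.Sec V)} (hD' : D' ∈ homDer p O V α)
    (hDD' : IsRestriction O h D D') {g : O.Sec V} {G : O.Sec U}
    (hG : O.res (hW.trans h) G = O.res hW g) :
    O.res hW (D' g) = O.res (hW.trans h) (D G) := by
  rw [← res_res O h hW, ← hDD']
  exact homDer_local hO hW hD' (by rw [res_res, hG])

lemma IsRestriction.unique (hO : O.HasBumps) {U V : Opens X} (h : V ≤ U) {α : GK I}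
    {D : Module.End ℝ (O.Sec U)} {D' D'' : Module.End ℝ (O.Sec V)}
    (hD' : D' ∈ homDer p O V α) (hD'' : D'' ∈ homDer p O V α)
    (h' : IsRestriction O h D D') (h'' : IsRestriction O h D D'') : D' = D'' := by
  refine LinearMap.ext fun g => eq_of_locally_eq fun x hx => ?_
  obtain ⟨W, hW, G, hxW, hG, -⟩ := hO.exists_extension h hx g
  exact ⟨W, hW, hxW, by rw [h'.res_eq hO h hW hD' hG, h''.res_eq hO h hW hD'' hG]⟩

/-- An operator that acts locally like derivations of degree `α` is one. -/
lemma mem_homDer_of_locally {U : Opens X} {α : GK I} {D : Module.End ℝ (O.Sec U)}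
    (H : ∀ f g : O.Sec U, ∀ x ∈ U, ∃ (V U' : Opens X) (hV : V ≤ U) (h : V ≤ U'),
      ∃ E ∈ homDer p O U' α, ∃ F G : O.Sec U', x ∈ V ∧
        (∀ i, f ∈ O.homog U i → F ∈ O.homog U' i) ∧
        O.res h F = O.res hV f ∧ O.res h G = O.res hV g ∧
        O.res hV (D f) = O.res h (E F) ∧ O.res hV (D g) = O.res h (E G) ∧
        O.res hV (D (f * g)) = O.res h (E (F * G))) :
    D ∈ homDer p O U α := by
  refine ⟨fun i j hij f hf => mem_homog_of_locally fun x hx => ?_,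
    fun i hi f hf => eq_of_locally_eq fun x hx => ?_,
    fun i f hf g => eq_of_locally_eq fun x hx => ?_⟩
  · obtain ⟨V, U', hV, h, E, hE, F, G, hxV, hF, -, -, h1, -, -⟩ := H f f x hx
    exact ⟨V, hV, hxV, by rw [h1]; exact res_mem_homog _ (hE.1 i j hij F (hF i hf))⟩
  · obtain ⟨V, U', hV, h, E, hE, F, G, hxV, hF, -, -, h1, -, -⟩ := H f f x hx
    exact ⟨V, hV, hxV, by rw [h1, hE.2.1 i hi F (hF i hf), map_zero, map_zero]⟩
  · obtain ⟨V, U', hV, h, E, hE, F, G, hxV, hF, hFf, hGg, h1, h2, h3⟩ := H f g x hx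
    refine ⟨V, hV, hxV, ?_⟩
    rw [h3, hE.2.2 i F (hF i hf) G]
    simp only [map_add, map_mul, map_smul, h1, h2, hFf, hGg]

theorem exists_restriction (hO : O.HasBumps) {U V : Opens X} (h : V ≤ U) {α : GK I}
    {D : Module.End ℝ (O.Sec U)} (hD : D ∈ homDer p O U α) :
    ∃ D' ∈ homDer p O V α, IsRestriction O h D D' := by
  -- `s` is to be `D' g`. Quantifying over every local extension `G`, not just the chosen ones, lets
  -- sums, multiples and products of extensions be used below.
  have key : ∀ g : O.Sec V, ∃ s : O.Sec V, ∀ (W : Opens X) (hW : W ≤ V) (G : O.Sec U),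
      O.res (hW.trans h) G = O.res hW g → O.res hW s = O.res (hW.trans h) (D G) := by
    intro g
    choose W hW G hxW hG _ using fun x : V => hO.exists_extension h x.2 g
    have hc : V ≤ iSup W := fun x hx => Opens.mem_iSup.2 ⟨⟨x, hx⟩, hxW _⟩
    obtain ⟨s, hs⟩ := exists_glue (O := O) W hW hc (fun x => O.res ((hW x).trans h) (D (G x)))
      -- Two extensions of `g` agree on the overlap, so their images under `D` do too, by locality.
      (fun x y => by
        rw [res_res, res_res]
        refine homDer_local hO _ hD ?_
        rw [← res_res O ((hW x).trans h) inf_le_left, hG, res_res,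
          ← res_res O ((hW y).trans h) inf_le_right, hG, res_res])
    refine ⟨s, fun W' hW' G' hG' => eq_of_locally_eq fun y hy => ?_⟩
    refine ⟨W' ⊓ W ⟨y, hW' hy⟩, inf_le_left, ⟨hy, hxW _⟩, ?_⟩
    rw [res_res, ← res_res O (hW ⟨y, hW' hy⟩) inf_le_right, hs, res_res, res_res]
    refine homDer_local hO _ hD ?_
    rw [← res_res O ((hW _).trans h) inf_le_right, hG, res_res,
      ← res_res O (hW'.trans h) inf_le_left, hG', res_res]
  choose D' hD' using key
  -- Simultaneous extensions on one neighbourhood. Only `F` must keep the degree, as the Leibniz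
  -- rule asks for homogeneity of its first factor alone.
  have ext₂ : ∀ f g : O.Sec V, ∀ x ∈ V, ∃ (W : Opens X) (hW : W ≤ V) (F G : O.Sec U), x ∈ W ∧
      O.res (hW.trans h) F = O.res hW f ∧ O.res (hW.trans h) G = O.res hW g ∧
      ∀ i, f ∈ O.homog V i → F ∈ O.homog U i := by
    intro f g x hx
    obtain ⟨W, hW, F, hxW, hF, hF'⟩ := hO.exists_extension h hx f
    obtain ⟨W', hW', G, hxW', hG, -⟩ := hO.exists_extension h hx g
    refine ⟨W ⊓ W', inf_le_left.trans hW, F, G, ⟨hxW, hxW'⟩, ?_, ?_, hF'⟩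
    · rw [← res_res O (hW.trans h) inf_le_left, hF, res_res]
    · rw [← res_res O (hW'.trans h) inf_le_right, hG, res_res]
  let L : Module.End ℝ (O.Sec V) :=
    { toFun := D'
      map_add' := fun f g => eq_of_locally_eq fun x hx => by
        obtain ⟨W, hW, F, G, hxW, hF, hG, -⟩ := ext₂ f g x hx
        refine ⟨W, hW, hxW, ?_⟩
        rw [hD' (f + g) W hW (F + G) (by rw [map_add, map_add, hF, hG]), map_add, map_add, map_add,
          hD' f W hW F hF, hD' g W hW G hG]
      map_smul' := fun c f => eq_of_locally_eq fun x hx => by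
        obtain ⟨W, hW, F, G, hxW, hF, -, -⟩ := ext₂ f f x hx
        refine ⟨W, hW, hxW, ?_⟩
        rw [hD' (c • f) W hW (c • F) (by rw [map_smul, map_smul, hF]), map_smul, map_smul,
          RingHom.id_apply, map_smul, hD' f W hW F hF] }
  refine ⟨L, mem_homDer_of_locally fun f g x hx => ?_, fun f => ?_⟩
  · obtain ⟨W, hW, F, G, hxW, hF, hG, hFi⟩ := ext₂ f g x hx
    exact ⟨W, U, hW, hW.trans h, D, hD, F, G, hxW, hFi, hF, hG, hD' f W hW F hF, hD' g W hW G hG,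
      hD' (f * g) W hW (F * G) (by rw [map_mul, map_mul, hF, hG])⟩
  -- `f` itself is an extension of its restriction, on all of `V`.
  · have := hD' (O.res h f) V le_rfl f (by rw [res_res])
    rwa [res_self] at this

end Local

/-! ### The sheaf of vector fields -/

section SheafOfVectorFields

variable {I : Type w} [NonUnitalCommSemiring I] {X : TopCat.{u}}
variable {p : I →+ ZMod 2} {O : GradedRingedSpace I X}

open GradedRingedSpace

lemma IsRestriction.trans {U V W : Opens X} {h : V ≤ U} {h' : W ≤ V} {D : Module.End ℝ (O.Sec U)}
    {D' : Module.End ℝ (O.Sec V)} {D'' : Module.End ℝ (O.Sec W)} (hD : IsRestriction O h D D')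
    (hD' : IsRestriction O h' D' D'') : IsRestriction O (h'.trans h) D D'' := fun f => by
  rw [← res_res O h h', hD', hD, res_res]

/-- The restriction of derivations of degree `α` to a smaller open set. -/
def restrictDer (hO : O.HasBumps) {U V : Opens X} (h : V ≤ U) (α : GK I) :
    homDer p O U α →ₗ[ℝ] homDer p O V α :=
  have ex (D : homDer p O U α) : ∃ D' : homDer p O V α, IsRestriction O h D.1 D'.1 :=
    let ⟨D', hD', hr⟩ := exists_restriction hO h D.2
    ⟨⟨D', hD'⟩, hr⟩
  { toFun := fun D => (ex D).choose
    -- The sum of the chosen restrictions also restricts `D + E`, so uniqueness makes the choice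
    -- additive; scalars are treated alike.
    map_add' := fun D E => Subtype.ext <| IsRestriction.unique hO h (D := (D + E).1)
      (ex (D + E)).choose.2 ((ex D).choose + (ex E).choose).2 (ex (D + E)).choose_spec fun f =>
        (congrArg₂ (· + ·) ((ex D).choose_spec f) ((ex E).choose_spec f)).trans
          (map_add (O.res h) (D.1 f) (E.1 f)).symm
    map_smul' := fun c D => Subtype.ext <| IsRestriction.unique hO h (D := (c • D).1)
      (ex (c • D)).choose.2 (c • (ex D).choose).2 (ex (c • D)).choose_spec fun f =>
        (congrArg (c • ·) ((ex D).choose_spec f)).trans (map_smul (O.res h) c (D.1 f)).symm }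

lemma restrictDer_isRestriction (hO : O.HasBumps) {U V : Opens X} (h : V ≤ U) (α : GK I)
    (D : homDer p O U α) : IsRestriction O h D.1 (restrictDer hO h α D).1 :=
  Exists.choose_spec (p := fun D' : homDer p O V α => IsRestriction O h D.1 D'.1) _

/-- The restriction maps of vector fields, in the presence of bump functions. -/
def restrictions (hO : O.HasBumps) : Restrictions p O where
  map h α := restrictDer hO h α
  isRestriction h α D := restrictDer_isRestriction hO h α D
  map_id U α := LinearMap.ext fun D => Subtype.ext <| IsRestriction.unique hO le_rfl
    (restrictDer hO le_rfl α D).2 D.2 (restrictDer_isRestriction hO le_rfl α D)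
    fun f => by rw [res_self, res_self, LinearMap.id_apply]
  map_comp h h' α := LinearMap.ext fun D => Subtype.ext <| IsRestriction.unique hO (h'.trans h)
    (restrictDer hO (h'.trans h) α D).2 (restrictDer hO h' α (restrictDer hO h α D)).2
    (restrictDer_isRestriction hO (h'.trans h) α D)
    ((restrictDer_isRestriction hO h α D).trans
      (restrictDer_isRestriction hO h' α (restrictDer hO h α D)))

namespace Restrictions

variable (R : Restrictions p O)

/-- Compatible vector fields of degree `α` have a unique gluing. -/
lemma existsUnique_glue (hO : O.HasBumps) {α : GK I} {ι : Type*} {U : Opens X} (V : ι → Opens X)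
    (hV : ∀ a, V a ≤ U) (hc : U ≤ iSup V) (D : ∀ a, homDer p O (V a) α)
    (hD : ∀ a b, R.map (inf_le_left : V a ⊓ V b ≤ V a) α (D a) =
      R.map (inf_le_right : V a ⊓ V b ≤ V b) α (D b)) :
    ∃! E : homDer p O U α, ∀ a, R.map (hV a) α E = D a := by
  -- The local values `D a (f|V a)` agree on overlaps, because both restrict to the value there of
  -- the common restriction of `D a` and `D b`.
  have key : ∀ f : O.Sec U, ∃ s : O.Sec U, ∀ a, O.res (hV a) s = (D a).1 (O.res (hV a) f) := by
    intro f
    refine exists_glue V hV hc _ fun a b => ?_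
    rw [← R.isRestriction inf_le_left α (D a), ← R.isRestriction inf_le_right α (D b), hD,
      res_res, res_res]
  choose E hE using key
  let L : Module.End ℝ (O.Sec U) :=
    { toFun := E
      map_add' := fun f g => eq_of_cover V hV hc fun a => by
        rw [hE, map_add, map_add, map_add, hE, hE]
      map_smul' := fun c f => eq_of_cover V hV hc fun a => by
        rw [hE, map_smul, map_smul, RingHom.id_apply, map_smul, hE] }
  have hL : L ∈ homDer p O U α := mem_homDer_of_locally fun f g x hx => by
    obtain ⟨a, ha⟩ := Opens.mem_iSup.1 (hc hx)
    refine ⟨V a, V a, hV a, le_rfl, (D a).1, (D a).2, O.res (hV a) f, O.res (hV a) g, ha,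
      fun i hi => res_mem_homog _ hi, res_self O _, res_self O _, ?_, ?_, ?_⟩
    · rw [res_self]; exact hE f a
    · rw [res_self]; exact hE g a
    · rw [res_self, ← map_mul]; exact hE (f * g) a
  refine ⟨⟨L, hL⟩, fun a => Subtype.ext ?_, fun E' hE' => Subtype.ext (LinearMap.ext fun f => ?_)⟩
  -- `R.map` is known only through `isRestriction`; uniqueness identifies it with `D a`.
  · exact IsRestriction.unique hO (hV a) (R.map (hV a) α ⟨L, hL⟩).2 (D a).2
      (R.isRestriction (hV a) α ⟨L, hL⟩) fun f => (hE f a).symm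
  · refine eq_of_cover V hV hc fun a => ?_
    rw [← R.isRestriction (hV a) α E', hE']
    exact (hE f a).symm

lemma presheafDeg_isSheaf (hO : O.HasBumps) (α : GK I) : (R.presheafDeg α).IsSheaf := by
  rw [TopCat.Presheaf.isSheaf_iff_isSheafUniqueGluing]
  intro ι V D hD
  exact R.existsUnique_glue hO V (le_iSup V) le_rfl D hD

/-- Restriction and compatibility are componentwise, and sections form a full product over the
degrees, so no finiteness condition has to survive the gluing. -/
lemma presheaf_isSheaf (hO : O.HasBumps) : R.presheaf.IsSheaf := by
  rw [TopCat.Presheaf.isSheaf_iff_isSheafUniqueGluing]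
  intro ι V D hD
  have key : ∀ α : GK I, ∃! E : homDer p O (iSup V) α, ∀ a, R.map (le_iSup V a) α E = D a α :=
    fun α => R.existsUnique_glue hO V (le_iSup V) le_rfl (fun a => D a α)
      fun a b => congrFun (hD a b) α
  choose E hE hE' using key
  exact ⟨E, fun a => funext fun α => hE α a,
    fun E' h => funext fun α => hE' α (E' α) fun a => congrFun (h a) α⟩

end Restrictions

end SheafOfVectorFields

end MonGraded

end

theorem mainTheorem6 {I : Type w} [NonUnitalCommSemiring I] [IsCancelAdd I] [Countable I]
    (p : I →+ ZMod 2) (n : ℕ) (m : I →₀ ℕ)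
    (X : TopCat.{u}) [T2Space X] [SecondCountableTopology X]
    (M : MonGraded.GradedManifold p n m X) :
    (∀ (U V : TopologicalSpace.Opens X) (h : V ≤ U) (α : MonGraded.GK I),
      ∀ D ∈ MonGraded.homDer p M.toGradedRingedSpace U α,
        ∃! D', D' ∈ MonGraded.homDer p M.toGradedRingedSpace V α ∧
          MonGraded.IsRestriction M.toGradedRingedSpace h D D') ∧
    ∃ R : MonGraded.Restrictions p M.toGradedRingedSpace,
      (∀ α : MonGraded.GK I, (R.presheafDeg α).IsSheaf) ∧ R.presheaf.IsSheaf := by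
  have hM := M.hasBumps
  refine ⟨fun U V h α D hD => ?_, MonGraded.restrictions hM, fun α => ?_, ?_⟩
  · obtain ⟨D', hD', hr⟩ := MonGraded.exists_restriction hM h hD
    exact ⟨D', ⟨hD', hr⟩, fun D'' hD'' => hD''.2.unique hM h hD''.1 hD' hr⟩
  · exact MonGraded.Restrictions.presheafDeg_isSheaf _ hM α
  · exact MonGraded.Restrictions.presheaf_isSheaf _ hM
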